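/- \textbf{Proposition (Complexity is a generic property).} Let $\mathcal G=(\mathcal V,\mathcal E)$ be a directed graph with $\mathcal V=\{1,\dots,n\}$ and $\mathcal E\subseteq\mathcal V\times\mathcal V$, and let $\gamma_1,\dots,\gamma_n\in\mathbb R$ and $\Gamma=\mathrm{diag}(\gamma_1,\dots,\gamma_n)$. For edge weights $a\in\mathbb R^{\mathcal E}$ let $A\in\mathbb R^{n\times n}$ be the matrix with $[A]_{ij}=a_{ij}$, the weight of the edge $(j,i)$, if $(j,i)\in\mathcal E$, and $[A]_{ij}=0$ otherwise. Consider the network system $\dot x=(\Gamma+A)x+u$ with transfer function $W(s)=(sI-\Gamma-A)^{-1}$, and let $$\overline W(s)=(sI-\Gamma)\,W(s)\in\mathbb R(s)^{n\times n},\qquad \varphi=\delta_M(\overline W).$$ Here $\delta_M(G)$ denotes the McMillan degree of a rational matrix $G$: the sum, over the distinct poles $p\in\mathbb C\cup\{\infty\}$ of the entries of $G$, of the largest multiplicity that $p$ has as a pole over all minors of $G$. Let $\varphi_{\mathcal G}$ be the maximum of $\varphi$ over all edge weights $a\in\mathbb R^{\mathcal E}$. Then: \begin{enumerate} \item this maximum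 exists, and $\varphi=\varphi_{\mathcal G}$ for almost all choices of the edge weights, that is, for all $a\in\mathbb R^{\mathcal E}$ outside some proper algebraic subvariety of $\mathbb R^{\mathcal E}$; \item for every choice of the edge weights, $$\varphi=\sum_{c}\operatorname{rank}(C_c),$$ where $c$ ranges over the distinct values in $\{\gamma_1,\dots,\gamma_n\}$ and $C_c$ is the matrix $A$ with every column $h$ such that $\gamma_h\neq c$ replaced by zero. \end{enumerate} -/

import Mathlib

namespace NetworkComplexity

/-! ### Poles and McMillan degree of real rational matrices -/

/-- The multiplicity of a point `p` of `ℂ ∪ {∞}` as a pole of a real rational function `f`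
(zero if `p` is not a pole of `f`). At a finite point it is the multiplicity of the point as a
root of the reduced denominator; at infinity it is the excess of the degree of the numerator over
that of the denominator. -/
noncomputable def poleMultiplicity (f : RatFunc ℝ) (p : OnePoint ℂ) : ℕ :=
  p.elim f.intDegree.toNat
    (fun α => (f.denom.map (algebraMap ℝ ℂ)).rootMultiplicity α)

/-- `p ∈ ℂ ∪ {∞}` is a pole of a rational matrix if it is a pole of one of its entries. -/
def IsPole {q m : ℕ} (G : Matrix (Fin q) (Fin m) (RatFunc ℝ)) (p : OnePoint ℂ) : Prop :=
  ∃ i j, 0 < poleMultiplicity (G i j) p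

/-- The minors (of all sizes) of a rational matrix: the determinants of its square submatrices,
given by increasing choices of rows and columns. -/
def minors {q m : ℕ} (G : Matrix (Fin q) (Fin m) (RatFunc ℝ)) : Set (RatFunc ℝ) :=
  {d | ∃ (r : ℕ) (f : Fin r ↪o Fin q) (g : Fin r ↪o Fin m), d = (G.submatrix f g).det}

/-- A rational matrix has finitely many poles. -/
theorem finite_setOf_isPole {q m : ℕ} (G : Matrix (Fin q) (Fin m) (RatFunc ℝ)) :
    {p | IsPole G p}.Finite := by
  have h : {p | IsPole G p} ⊆ ⋃ i, ⋃ j, insert OnePoint.infty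
      ((fun α : ℂ => (α : OnePoint ℂ)) ''
        {α | ((G i j).denom.map (algebraMap ℝ ℂ)).IsRoot α}) := by
    rintro p ⟨i, j, hp⟩
    refine Set.mem_iUnion.2 ⟨i, Set.mem_iUnion.2 ⟨j, ?_⟩⟩
    induction p with
    | infty => exact Set.mem_insert _ _
    | coe α =>
      have h0 : (G i j).denom.map (algebraMap ℝ ℂ) ≠ 0 :=
        Polynomial.map_ne_zero (RatFunc.denom_ne_zero _)
      exact Set.mem_insert_of_mem _ ⟨α, (Polynomial.rootMultiplicity_pos h0).1 hp, rfl⟩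
  refine Set.Finite.subset (Set.finite_iUnion fun i => Set.finite_iUnion fun j => ?_) h
  refine ((Polynomial.finite_setOfPred_isRoot ?_).image _).insert _
  exact Polynomial.map_ne_zero (RatFunc.denom_ne_zero _)

/-- A matrix has finitely many minors. -/
theorem finite_minors {q m : ℕ} (G : Matrix (Fin q) (Fin m) (RatFunc ℝ)) :
    (minors G).Finite := by
  have h : minors G ⊆ ⋃ r : Fin (q + 1), Set.range
      (fun x : (Fin r ↪o Fin q) × (Fin r ↪o Fin m) => (G.submatrix x.1 x.2).det) := by
    rintro d ⟨r, f, g, rfl⟩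
    have hr : r ≤ q := by simpa using Fintype.card_le_of_embedding f.toEmbedding
    exact Set.mem_iUnion.2 ⟨⟨r, by omega⟩, (f, g), rfl⟩
  refine Set.Finite.subset (Set.finite_iUnion fun r => ?_) h
  have h1 : Finite (Fin r ↪o Fin q) :=
    Finite.of_injective (fun f => (f : Fin r → Fin q)) DFunLike.coe_injective
  have h2 : Finite (Fin r ↪o Fin m) :=
    Finite.of_injective (fun f => (f : Fin r → Fin m)) DFunLike.coe_injective
  exact Set.finite_range _

/-- The degree `δ(G; p)` of a pole `p`: the largest multiplicity that `p` has as a pole over all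
minors of `G` (a maximum over the finite set `minors G`). -/
noncomputable def poleDegree {q m : ℕ} (G : Matrix (Fin q) (Fin m) (RatFunc ℝ))
    (p : OnePoint ℂ) : ℕ :=
  (finite_minors G).toFinset.sup (fun d => poleMultiplicity d p)

/-- The McMillan degree `δ_M(G)`: the sum of the degrees of the distinct poles of `G` in
`ℂ ∪ {∞}`. -/
noncomputable def mcMillanDegree {q m : ℕ} (G : Matrix (Fin q) (Fin m) (RatFunc ℝ)) : ℕ :=
  ∑ p ∈ (finite_setOf_isPole G).toFinset, poleDegree G p

/-! ### The network system and its complexity -/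

/-- The interconnection matrix of the graph with node set `Fin n` and edge set `E`, for the edge
weights `w`: its `(i, j)` entry is the weight of the edge `(j, i)` if this is an edge, and zero
otherwise. -/
noncomputable def weightMatrix {n : ℕ} (E : Finset (Fin n × Fin n)) (w : E → ℝ) :
    Matrix (Fin n) (Fin n) ℝ :=
  Matrix.of fun i j => if h : (j, i) ∈ E then w ⟨(j, i), h⟩ else 0

/-- The resolvent denominator `s I - M` of a real matrix `M`, as a matrix over `ℝ(s)`. -/
noncomputable def sIMinus {n : ℕ} (M : Matrix (Fin n) (Fin n) ℝ) :
    Matrix (Fin n) (Fin n) (RatFunc ℝ) :=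
  Matrix.scalar (Fin n) RatFunc.X - M.map RatFunc.C

/-- `s I - M` is invertible over `ℝ(s)`. -/
theorem isUnit_det_sIMinus {n : ℕ} (M : Matrix (Fin n) (Fin n) ℝ) :
    IsUnit (sIMinus M).det := by
  have h : sIMinus M = M.charmatrix.map (algebraMap (Polynomial ℝ) (RatFunc ℝ)) := by
    ext i j : 2
    by_cases hij : i = j
    · subst hij
      simp [sIMinus]
    · simp [sIMinus, hij]
  have h2 : (sIMinus M).det = algebraMap (Polynomial ℝ) (RatFunc ℝ) M.charpoly := by
    rw [h, Matrix.charpoly, RingHom.map_det, RingHom.mapMatrix_apply]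
  rw [h2]
  exact (RatFunc.algebraMap_ne_zero M.charpoly_monic.ne_zero).isUnit

/-- The transfer function `W(s) = (s I - Γ - A)⁻¹`, with `Γ = diag(γ₁, …, γₙ)`. -/
noncomputable def transferFunction {n : ℕ} (γ : Fin n → ℝ) (A : Matrix (Fin n) (Fin n) ℝ) :
    Matrix (Fin n) (Fin n) (RatFunc ℝ) :=
  (sIMinus (Matrix.diagonal γ + A))⁻¹

/-- The filtered transfer function `W̄(s) = F(s) W(s)`, with the filter `F(s) = s I - Γ`. -/
noncomputable def filteredTransferFunction {n : ℕ} (γ : Fin n → ℝ)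
    (A : Matrix (Fin n) (Fin n) ℝ) : Matrix (Fin n) (Fin n) (RatFunc ℝ) :=
  sIMinus (Matrix.diagonal γ) * transferFunction γ A

/-- The complexity index `φ = δ_M(W̄)`. -/
noncomputable def complexityIndex {n : ℕ} (γ : Fin n → ℝ) (A : Matrix (Fin n) (Fin n) ℝ) : ℕ :=
  mcMillanDegree (filteredTransferFunction γ A)

/-- The structural complexity index `φ_G`: the maximum of the complexity index over all real edge
weights. -/
noncomputable def structuralComplexityIndex {n : ℕ} (γ : Fin n → ℝ)
    (E : Finset (Fin n × Fin n)) : ℕ :=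
  sSup (Set.range fun w : E → ℝ => complexityIndex γ (weightMatrix E w))

/-- The matrix `C_c` of a real number `c`: the matrix `A` with the columns of the nodes `h` with
`γ h ≠ c` replaced by zero. It is the coefficient of `1 / (s - c)` in `A (s I - Γ)⁻¹`. -/
noncomputable def columnPart {n : ℕ} (γ : Fin n → ℝ) (A : Matrix (Fin n) (Fin n) ℝ) (c : ℝ) :
    Matrix (Fin n) (Fin n) ℝ :=
  Matrix.of fun j h => if γ h = c then A j h else 0

/-- `P` holds for almost all parameters `w ∈ ℝ^ι`: it holds for all parameters that do not lie on
some proper algebraic subvariety of the parameter space. -/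
def ForAlmostAll {ι : Type*} (P : (ι → ℝ) → Prop) : Prop :=
  ∃ I : Ideal (MvPolynomial ι ℝ), MvPolynomial.zeroLocus ℝ I ≠ Set.univ ∧
    ∀ w : ι → ℝ, w ∉ MvPolynomial.zeroLocus ℝ I → P w

end NetworkComplexity

/-! The inverse of W̄ is R = I - A(sI - Γ)⁻¹ = I - ∑_c C_c/(s - c), whose poles are easy to read
off, and inversion preserves the McMillan degree (`mcMillanDegree_eq_of_mul_eq_one`). Indeed, by
Jacobi's identity each minor of G⁻¹ is, up to sign, a complementary minor of G divided by det G. The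
degree at p therefore changes by the order of det G at p, and these orders sum to zero over the
Riemann sphere.

The entries of R have poles only at the values c of γ, and near c the matrix is -C_c/(s - c) plus a
regular part. Expanding a minor by multilinearity, terms with more than rank C_c singular rows
vanish, so the degree at c is at most rank C_c (`poleDegree_returnDifference_le`). A nonzero minor
of C_c of size rank C_c shows that it is attained (`le_poleDegree_returnDifference`). This is the
rank formula.

Genericity follows: for each c, a minor of C_c that is nonzero at weights of maximal rank is a
nonzero polynomial in the weights. Off the zero set of the product of these polynomials all the
ranks are maximal at once, and so is their sum. -/

namespace NetworkComplexity

/-! ### Orders and pole multiplicities of rational functions on the Riemann sphere -/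

open Polynomial

/-- The order of a real rational function at a point of `ℂ ∪ {∞}`: positive at zeros, negative at
poles. By convention the zero function has order `0`. -/
noncomputable def pointOrder (p : OnePoint ℂ) (f : RatFunc ℝ) : ℤ :=
  p.elim (-f.intDegree)
    (fun α => ((f.num.map (algebraMap ℝ ℂ)).rootMultiplicity α : ℤ) -
      ((f.denom.map (algebraMap ℝ ℂ)).rootMultiplicity α : ℤ))

theorem pointOrder_infty (f : RatFunc ℝ) : pointOrder OnePoint.infty f = -f.intDegree := rfl

theorem pointOrder_coe (α : ℂ) (f : RatFunc ℝ) :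
    pointOrder (α : OnePoint ℂ) f = ((f.num.map (algebraMap ℝ ℂ)).rootMultiplicity α : ℤ) -
      ((f.denom.map (algebraMap ℝ ℂ)).rootMultiplicity α : ℤ) := rfl

theorem poleMultiplicity_infty (f : RatFunc ℝ) :
    poleMultiplicity f OnePoint.infty = f.intDegree.toNat := rfl

theorem poleMultiplicity_coe (f : RatFunc ℝ) (α : ℂ) :
    poleMultiplicity f (α : OnePoint ℂ) =
      (f.denom.map (algebraMap ℝ ℂ)).rootMultiplicity α := rfl

theorem map_ne_zero_of_ne_zero {q : ℝ[X]} (hq : q ≠ 0) : q.map (algebraMap ℝ ℂ) ≠ 0 :=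
  Polynomial.map_ne_zero hq

theorem poleMultiplicity_coe_eq_zero_iff (f : RatFunc ℝ) (α : ℂ) :
    poleMultiplicity f (α : OnePoint ℂ) = 0 ↔ aeval α f.denom ≠ 0 := by
  rw [poleMultiplicity_coe, rootMultiplicity_eq_zero_iff, IsRoot.def, eval_map_algebraMap]
  have := map_ne_zero_of_ne_zero f.denom_ne_zero
  tauto

/-- Numerator and denominator are coprime, so at a finite pole the numerator does not vanish. The
convention of order `0` for the zero function agrees with its having no poles. -/
theorem natCast_poleMultiplicity (f : RatFunc ℝ) (p : OnePoint ℂ) :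
    (poleMultiplicity f p : ℤ) = max 0 (-pointOrder p f) := by
  induction p with
  | infty =>
    rw [poleMultiplicity_infty, pointOrder_infty, Int.toNat_eq_max, neg_neg, max_comm]
  | coe α =>
    rw [pointOrder_coe]
    by_cases h : poleMultiplicity f (α : OnePoint ℂ) = 0
    · rw [h]
      rw [poleMultiplicity_coe] at h
      rw [h]
      simp
    · have h1 := (poleMultiplicity_coe_eq_zero_iff f α).not.1 h
      rw [not_not] at h1
      have h2 : (f.num.map (algebraMap ℝ ℂ)).rootMultiplicity α = 0 := by
        apply rootMultiplicity_eq_zero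
        rw [IsRoot.def, eval_map_algebraMap]
        intro h0
        obtain ⟨a, b, hab⟩ := RatFunc.isCoprime_num_denom f
        have := congrArg (aeval α) hab
        simp [h0, h1] at this
      rw [h2, poleMultiplicity_coe]
      simp

theorem pointOrder_mul (p : OnePoint ℂ) {f g : RatFunc ℝ} (hf : f ≠ 0) (hg : g ≠ 0) :
    pointOrder p (f * g) = pointOrder p f + pointOrder p g := by
  induction p with
  | infty =>
    simp only [pointOrder_infty, RatFunc.intDegree_mul hf hg]
    ring
  | coe α =>
    have h := congrArg (fun q => (q.map (algebraMap ℝ ℂ)).rootMultiplicity α)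
      (RatFunc.num_denom_mul f g)
    have hfn := map_ne_zero_of_ne_zero (RatFunc.num_ne_zero hf)
    have hgn := map_ne_zero_of_ne_zero (RatFunc.num_ne_zero hg)
    have hfgn := map_ne_zero_of_ne_zero (RatFunc.num_ne_zero (mul_ne_zero hf hg))
    have hfd := map_ne_zero_of_ne_zero f.denom_ne_zero
    have hgd := map_ne_zero_of_ne_zero g.denom_ne_zero
    have hfgd := map_ne_zero_of_ne_zero (f * g).denom_ne_zero
    simp only [Polynomial.map_mul] at h
    rw [rootMultiplicity_mul (mul_ne_zero hfgn (mul_ne_zero hfd hgd)),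
      rootMultiplicity_mul (mul_ne_zero hfd hgd),
      rootMultiplicity_mul (mul_ne_zero (mul_ne_zero hfn hgn) hfgd),
      rootMultiplicity_mul (mul_ne_zero hfn hgn)] at h
    simp only [pointOrder_coe]
    omega

theorem pointOrder_one (p : OnePoint ℂ) : pointOrder p 1 = 0 := by
  have h := pointOrder_mul p (one_ne_zero (α := RatFunc ℝ)) one_ne_zero
  rw [mul_one] at h
  omega

theorem pointOrder_neg (p : OnePoint ℂ) (f : RatFunc ℝ) :
    pointOrder p (-f) = pointOrder p f := by
  by_cases hf : f = 0
  · simp [hf]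
  have h1 : (-1 : RatFunc ℝ) ≠ 0 := neg_ne_zero.2 one_ne_zero
  -- (-1)² = 1 forces the order of -1 to be zero.
  have h := pointOrder_mul p h1 h1
  rw [neg_mul_neg, one_mul, pointOrder_one] at h
  rw [neg_eq_neg_one_mul, pointOrder_mul p h1 hf]
  omega

theorem pointOrder_units_mul (p : OnePoint ℂ) (u : ℤˣ) (f : RatFunc ℝ) :
    pointOrder p (((u : ℤ) : RatFunc ℝ) * f) = pointOrder p f := by
  rcases Int.units_eq_one_or u with rfl | rfl <;> simp [pointOrder_neg]

theorem pointOrder_inv (p : OnePoint ℂ) (f : RatFunc ℝ) :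
    pointOrder p f⁻¹ = -pointOrder p f := by
  by_cases hf : f = 0
  · subst hf
    have h : pointOrder p 0 = 0 := by
      induction p with
      | infty => simp [pointOrder_infty]
      | coe α => simp [pointOrder_coe, rootMultiplicity_eq_zero]
    simp [h]
  · have h := pointOrder_mul p hf (inv_ne_zero hf)
    rw [mul_inv_cancel₀ hf, pointOrder_one] at h
    omega

theorem pointOrder_pow (p : OnePoint ℂ) {f : RatFunc ℝ} (hf : f ≠ 0) (k : ℕ) :
    pointOrder p (f ^ k) = k * pointOrder p f := by
  induction k with
  | zero => simp [pointOrder_one]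
  | succ k ih =>
    rw [pow_succ, pointOrder_mul p (pow_ne_zero k hf) hf, ih]
    push_cast
    ring

theorem pointOrder_algebraMap (α : ℂ) (q : ℝ[X]) :
    pointOrder (α : OnePoint ℂ) (algebraMap ℝ[X] (RatFunc ℝ) q) =
      (q.map (algebraMap ℝ ℂ)).rootMultiplicity α := by
  simp [pointOrder_coe, rootMultiplicity_eq_zero]

/-- The total number of zeros and poles of a nonzero rational function on the Riemann sphere,
counted with sign, is zero. -/
theorem exists_finset_pointOrder_sum_eq_zero (f : RatFunc ℝ) :
    ∃ T₀ : Finset ℂ, ∀ T : Finset ℂ, T₀ ⊆ T →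
      pointOrder OnePoint.infty f + ∑ α ∈ T, pointOrder (α : OnePoint ℂ) f = 0 := by
  -- Over ℂ the root multiplicities add up to the degree. Points beyond the roots contribute
  -- nothing, so any larger `T` serves; this leaves room to include poles of matrices later.
  have key : ∀ (q : ℝ[X]) (T : Finset ℂ), (q.map (algebraMap ℝ ℂ)).roots.toFinset ⊆ T →
      ∑ α ∈ T, (q.map (algebraMap ℝ ℂ)).rootMultiplicity α = q.natDegree := by
    intro q T hT
    simp only [← count_roots]
    rw [Multiset.sum_count_eq_card fun a ha => hT (Multiset.mem_toFinset.2 ha),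
      ← (IsAlgClosed.splits (q.map (algebraMap ℝ ℂ))).natDegree_eq_card_roots, natDegree_map]
  refine ⟨(f.num.map (algebraMap ℝ ℂ)).roots.toFinset ∪
    (f.denom.map (algebraMap ℝ ℂ)).roots.toFinset, fun T hT => ?_⟩
  have h1 := key f.num T (Finset.union_subset_left hT)
  have h2 := key f.denom T (Finset.union_subset_right hT)
  simp only [pointOrder_infty, pointOrder_coe, Finset.sum_sub_distrib, ← Nat.cast_sum, h1, h2,
    RatFunc.intDegree]
  ring

/-- The ring of rational functions without a pole at `p`. -/
noncomputable def regularSubring (p : OnePoint ℂ) : Subring (RatFunc ℝ) where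
  carrier := {f | poleMultiplicity f p = 0}
  zero_mem' := by
    induction p with
    | infty => simp [poleMultiplicity_infty]
    | coe α => simp [poleMultiplicity_coe_eq_zero_iff]
  one_mem' := by
    induction p with
    | infty => simp [poleMultiplicity_infty]
    | coe α => simp [poleMultiplicity_coe_eq_zero_iff]
  neg_mem' := by
    intro f hf
    have h := natCast_poleMultiplicity (-f) p
    rw [pointOrder_neg, ← natCast_poleMultiplicity] at h
    have hf' : poleMultiplicity f p = 0 := hf
    simpa [hf'] using h
  add_mem' := by
    intro f g hf hg
    induction p with
    | infty =>
      simp only [poleMultiplicity_infty, Set.mem_ofPred_eq, Int.toNat_eq_zero] at *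
      by_cases h0 : g = 0
      · simpa [h0] using hf
      by_cases h1 : f + g = 0
      · simp [h1]
      exact (RatFunc.intDegree_add_le h0 h1).trans (max_le hf hg)
    | coe α =>
      simp only [poleMultiplicity_coe_eq_zero_iff, Set.mem_ofPred_eq] at *
      obtain ⟨r, hr⟩ := RatFunc.denom_add_dvd f g
      intro h
      have := congrArg (aeval α) hr
      simp [h, hf, hg] at this
  mul_mem' := by
    intro f g hf hg
    induction p with
    | infty =>
      simp only [poleMultiplicity_infty, Set.mem_ofPred_eq, Int.toNat_eq_zero] at *
      by_cases h0 : f = 0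
      · simp [h0]
      by_cases h1 : g = 0
      · simp [h1]
      rw [RatFunc.intDegree_mul h0 h1]
      omega
    | coe α =>
      simp only [poleMultiplicity_coe_eq_zero_iff, Set.mem_ofPred_eq] at *
      obtain ⟨r, hr⟩ := RatFunc.denom_mul_dvd f g
      intro h
      have := congrArg (aeval α) hr
      simp [h, hf, hg] at this

theorem mem_regularSubring {p : OnePoint ℂ} {f : RatFunc ℝ} :
    f ∈ regularSubring p ↔ poleMultiplicity f p = 0 := Iff.rfl

theorem det_mem_subring {R ι : Type*} [CommRing R] [Fintype ι] [DecidableEq ι] (S : Subring R)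
    {M : Matrix ι ι R} (h : ∀ i j, M i j ∈ S) : M.det ∈ S := by
  rw [Matrix.det_apply]
  refine S.sum_mem fun σ _ => ?_
  rw [Units.smul_def]
  exact zsmul_mem (S.prod_mem fun i _ => h _ _) _

/-! ### McMillan degrees of inverse matrices -/

theorem poleMultiplicity_le_poleDegree {q m r : ℕ} (G : Matrix (Fin q) (Fin m) (RatFunc ℝ))
    (p : OnePoint ℂ) (f : Fin r ↪o Fin q) (g : Fin r ↪o Fin m) :
    poleMultiplicity (G.submatrix f g).det p ≤ poleDegree G p :=
  Finset.le_sup (f := fun d => poleMultiplicity d p)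
    ((Set.Finite.mem_toFinset _).2 ⟨r, f, g, rfl⟩)

theorem poleDegree_le {q m : ℕ} {G : Matrix (Fin q) (Fin m) (RatFunc ℝ)}
    {p : OnePoint ℂ} {k : ℕ}
    (h : ∀ (r : ℕ) (f : Fin r ↪o Fin q) (g : Fin r ↪o Fin m),
      poleMultiplicity (G.submatrix f g).det p ≤ k) :
    poleDegree G p ≤ k := by
  refine Finset.sup_le fun d hd => ?_
  obtain ⟨r, f, g, rfl⟩ := (Set.Finite.mem_toFinset _).1 hd
  exact h r f g

theorem poleDegree_eq_zero_of_forall {q m : ℕ} {G : Matrix (Fin q) (Fin m) (RatFunc ℝ)}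
    {p : OnePoint ℂ} (h : ∀ i j, G i j ∈ regularSubring p) : poleDegree G p = 0 :=
  Nat.le_zero.1 (poleDegree_le fun _ _ _ =>
    (mem_regularSubring.1 (det_mem_subring _ fun _ _ => h _ _)).le)

/-- Points that are not poles have degree zero. This allows two matrices to be summed over a common
set of points. -/
theorem mcMillanDegree_eq_sum {q m : ℕ} {G : Matrix (Fin q) (Fin m) (RatFunc ℝ)}
    {S : Finset (OnePoint ℂ)} (hS : ∀ p, IsPole G p → p ∈ S) :
    mcMillanDegree G = ∑ p ∈ S, poleDegree G p := by
  refine Finset.sum_subset (fun p hp => hS p (by simpa using hp)) ?_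
  intro p _ hp
  rw [Set.Finite.mem_toFinset] at hp
  refine poleDegree_eq_zero_of_forall fun i j => ?_
  by_contra h
  exact hp ⟨i, j, Nat.pos_of_ne_zero h⟩

/-- Jacobi's identity on complementary minors of inverse matrices, up to sign. -/
theorem exists_det_mul_det_submatrix_eq {R ι κ n : Type*} [CommRing R] [Fintype ι] [Fintype κ]
    [Fintype n] [DecidableEq ι] [DecidableEq κ] [DecidableEq n] {G H : Matrix n n R}
    (h : G * H = 1) (e₁ e₂ : ι ⊕ κ ≃ n) :
    ∃ u : ℤˣ, ((u : ℤ) : R) * (G.det * (H.submatrix (e₁ ∘ Sum.inl) (e₂ ∘ Sum.inl)).det) =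
      (G.submatrix (e₂ ∘ Sum.inr) (e₁ ∘ Sum.inr)).det := by
  set N := G.submatrix e₂ e₁ with hN
  set N' := H.submatrix e₁ e₂ with hN'
  have hdet : N.det = ((Equiv.Perm.sign (e₁.symm.trans e₂) : ℤ) : R) * G.det := by
    rw [← Matrix.det_permute, ← Matrix.det_submatrix_equiv_self e₁]
    congr 1
    ext i j
    simp [hN]
  have hmul : N * N' = 1 := by
    rw [hN, hN', Matrix.submatrix_mul_equiv, h, Matrix.submatrix_one_equiv]
  rw [← Matrix.fromBlocks_toBlocks N, ← Matrix.fromBlocks_toBlocks N',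
    Matrix.fromBlocks_multiply, ← Matrix.fromBlocks_one, Matrix.fromBlocks_inj] at hmul
  -- Replacing the second block column of `N'` by that of the identity turns `N * N' = 1` into a
  -- triangular product; determinants then give `det N * det N'₁₁ = det N₂₂`.
  have key : N * Matrix.fromBlocks N'.toBlocks₁₁ 0 N'.toBlocks₂₁ 1 =
      Matrix.fromBlocks 1 N.toBlocks₁₂ 0 N.toBlocks₂₂ := by
    conv_lhs => rw [← Matrix.fromBlocks_toBlocks N]
    rw [Matrix.fromBlocks_multiply, hmul.1, hmul.2.2.1]
    simp
  have := congrArg Matrix.det key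
  rw [Matrix.det_mul, Matrix.det_fromBlocks_zero₁₂, Matrix.det_fromBlocks_zero₂₁, hdet,
    Matrix.det_one, Matrix.det_one, mul_one, one_mul, mul_assoc] at this
  exact ⟨_, this⟩

/-- The complement is listed in increasing order so that the complementary minor in Jacobi's
identity is again one of `minors`. -/
theorem exists_equiv_extending {n r k : ℕ} (hk : r + k = n) (f : Fin r ↪o Fin n) :
    ∃ (e : Fin r ⊕ Fin k ≃ Fin n) (f' : Fin k ↪o Fin n),
      e ∘ Sum.inl = f ∧ e ∘ Sum.inr = f' := by
  have h1 : (Finset.univ.map f.toEmbedding).card = r := by simp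
  have h2 : ((Finset.univ.map f.toEmbedding)ᶜ).card = k := by
    rw [Finset.card_compl, h1, Fintype.card_fin]
    omega
  refine ⟨finSumEquivOfFinset h1 h2, Finset.orderEmbOfFin _ h2, ?_, ?_⟩
  · ext1 i
    rw [Function.comp_apply, finSumEquivOfFinset_inl]
    refine congrFun (Finset.orderEmbOfFin_unique h1 (fun x => ?_) f.strictMono).symm i
    simp
  · ext1 i
    simp

theorem poleDegree_le_of_mul_eq_one {n : ℕ} {G H : Matrix (Fin n) (Fin n) (RatFunc ℝ)}
    (h : G * H = 1) (p : OnePoint ℂ) :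
    (poleDegree H p : ℤ) ≤ poleDegree G p + pointOrder p G.det := by
  have hG : G.det ≠ 0 := (Matrix.isUnit_det_of_right_inverse h).ne_zero
  -- Pole multiplicities are truncated at zero, so the bound itself must be nonnegative; the full
  -- minor `G.det` ensures this.
  have hfull : -pointOrder p G.det ≤ poleDegree G p := by
    have h1 := poleMultiplicity_le_poleDegree G p (RelEmbedding.refl _) (RelEmbedding.refl _)
    have h2 := natCast_poleMultiplicity G.det p
    have h3 : poleMultiplicity G.det p ≤ poleDegree G p := h1
    omega
  have hnonneg : 0 ≤ (poleDegree G p : ℤ) + pointOrder p G.det := by omega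
  lift (poleDegree G p : ℤ) + pointOrder p G.det to ℕ using hnonneg with N hN
  refine Int.ofNat_le.2 (poleDegree_le fun r f g => ?_)
  have hr : r ≤ n := by simpa using Fintype.card_le_of_embedding f.toEmbedding
  obtain ⟨e₁, f', he₁, hf'⟩ := exists_equiv_extending (Nat.add_sub_of_le hr) f
  obtain ⟨e₂, g', he₂, hg'⟩ := exists_equiv_extending (Nat.add_sub_of_le hr) g
  obtain ⟨u, hu⟩ := exists_det_mul_det_submatrix_eq h e₁ e₂
  rw [he₁, he₂, hf', hg'] at hu
  by_cases hd : (H.submatrix f g).det = 0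
  · rw [hd]
    exact (mem_regularSubring.1 (zero_mem (regularSubring p))).trans_le (Nat.zero_le _)
  · have h1 := congrArg (pointOrder p) hu
    rw [pointOrder_units_mul, pointOrder_mul p hG hd] at h1
    have h2 := natCast_poleMultiplicity (G.submatrix g' f').det p
    have h3 := poleMultiplicity_le_poleDegree G p g' f'
    have h4 := natCast_poleMultiplicity (H.submatrix f g).det p
    omega

theorem poleDegree_eq_of_mul_eq_one {n : ℕ} {G H : Matrix (Fin n) (Fin n) (RatFunc ℝ)}
    (h : G * H = 1) (p : OnePoint ℂ) :
    (poleDegree H p : ℤ) = poleDegree G p + pointOrder p G.det := by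
  have h1 := poleDegree_le_of_mul_eq_one h p
  have h2 := poleDegree_le_of_mul_eq_one (mul_eq_one_comm.1 h) p
  have h3 : H.det = G.det⁻¹ := by
    have := congrArg Matrix.det h
    rw [Matrix.det_mul, Matrix.det_one] at this
    exact eq_inv_of_mul_eq_one_right this
  rw [h3, pointOrder_inv] at h2
  omega

/-- The McMillan degree of an invertible square rational matrix is that of its inverse. -/
theorem mcMillanDegree_eq_of_mul_eq_one {n : ℕ} {G H : Matrix (Fin n) (Fin n) (RatFunc ℝ)}
    (h : G * H = 1) : mcMillanDegree H = mcMillanDegree G := by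
  classical
  obtain ⟨T₀, hT₀⟩ := exists_finset_pointOrder_sum_eq_zero G.det
  let P := (finite_setOf_isPole G).toFinset ∪ (finite_setOf_isPole H).toFinset
  -- Large enough to contain the finite poles of both matrices and all finite zeros and poles of
  -- `G.det`.
  let T : Finset ℂ := T₀ ∪ P.preimage (fun α : ℂ => (α : OnePoint ℂ))
    (OnePoint.coe_injective.injOn)
  have hsum : ∀ f : OnePoint ℂ → ℤ,
      ∑ p ∈ insert OnePoint.infty (T.image (fun α : ℂ => (α : OnePoint ℂ))), f p =
        f OnePoint.infty + ∑ α ∈ T, f (α : OnePoint ℂ) := by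
    intro f
    rw [Finset.sum_insert (by simp), Finset.sum_image OnePoint.coe_injective.injOn]
  have hS : ∀ p ∈ P, p ∈ insert OnePoint.infty (T.image (fun α : ℂ => (α : OnePoint ℂ))) := by
    intro p hp
    induction p with
    | infty => simp
    | coe α =>
      refine Finset.mem_insert_of_mem (Finset.mem_image_of_mem _ ?_)
      exact Finset.mem_union_right _ (Finset.mem_preimage.2 hp)
  have hG := mcMillanDegree_eq_sum (G := G) fun p hp =>
    hS p (Finset.mem_union_left _ ((Set.Finite.mem_toFinset _).2 hp))
  have hH := mcMillanDegree_eq_sum (G := H) fun p hp =>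
    hS p (Finset.mem_union_right _ ((Set.Finite.mem_toFinset _).2 hp))
  zify
  rw [hG, hH, Nat.cast_sum, Nat.cast_sum, Finset.sum_congr rfl fun p _ =>
    poleDegree_eq_of_mul_eq_one h p, Finset.sum_add_distrib, hsum (fun p => pointOrder p G.det),
    hT₀ T Finset.subset_union_left, add_zero]

/-! ### Rank and minors -/

theorem exists_orderEmbedding_linearIndependent_row {K : Type*} [Field K] {q m r : ℕ}
    {M : Matrix (Fin q) (Fin m) K} (h : M.rank = r) :
    ∃ f : Fin r ↪o Fin q, LinearIndependent K (M.submatrix f id).row := by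
  -- A basis of the row space is chosen among the rows, and its row indices are then sorted.
  obtain ⟨κ, a, ha, hspan, hli⟩ := exists_linearIndependent' K M.row
  have hκ : Finite κ := Finite.of_injective a ha
  have := Fintype.ofFinite κ
  have hcard : (Finset.univ.map ⟨a, ha⟩).card = r := by
    rw [Finset.card_map, Finset.card_univ, ← h, Matrix.rank_eq_finrank_span_row, ← hspan,
      finrank_span_eq_card hli]
  let e := Finset.orderEmbOfFin _ hcard
  have he : ∀ i, ∃ k, a k = e i := fun i => by
    obtain ⟨k, _, hk⟩ := Finset.mem_map.1 (Finset.orderEmbOfFin_mem _ hcard i)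
    exact ⟨k, hk⟩
  choose b hb using he
  have hb' : Function.Injective b := fun i j hij => by
    apply e.injective
    rw [← hb, ← hb, hij]
  refine ⟨e, ?_⟩
  have heq : (M.submatrix e id).row = (M.row ∘ a) ∘ b := by
    funext i
    change M (e i) = M (a (b i))
    rw [hb]
  rw [heq]
  exact hli.comp b hb'

theorem exists_det_submatrix_ne_zero_of_rank_eq {K : Type*} [Field K] {q m r : ℕ}
    {M : Matrix (Fin q) (Fin m) K} (h : M.rank = r) :
    ∃ (f : Fin r ↪o Fin q) (g : Fin r ↪o Fin m), (M.submatrix f g).det ≠ 0 := by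
  obtain ⟨f, hf⟩ := exists_orderEmbedding_linearIndependent_row h
  have h1 : (M.submatrix f id).transpose.rank = r := by
    rw [Matrix.rank_transpose, hf.rank_matrix, Fintype.card_fin]
  obtain ⟨g, hg⟩ := exists_orderEmbedding_linearIndependent_row h1
  refine ⟨f, g, ?_⟩
  rw [← Matrix.det_transpose]
  have h2 := (Matrix.linearIndependent_rows_iff_isUnit
    (A := (M.submatrix f g).transpose)).1 hg
  exact ((Matrix.isUnit_iff_isUnit_det _).1 h2).ne_zero

theorem le_rank_of_det_submatrix_ne_zero {K : Type*} [Field K] {q m r : ℕ}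
    {M : Matrix (Fin q) (Fin m) K} {f : Fin r → Fin q} {g : Fin r → Fin m}
    (h : (M.submatrix f g).det ≠ 0) : r ≤ M.rank := by
  have h1 := Matrix.rank_submatrix_le M f g
  rwa [Matrix.rank_of_det_ne_zero h, Fintype.card_fin] at h1

/-- Rows of a small-rank matrix, extended by arbitrary rows, give a singular matrix. -/
theorem det_piecewise_eq_zero_of_rank_lt {K L ι : Type*} [Field K] [Field L] [Fintype ι]
    [DecidableEq ι] (φ : K →+* L) (C : Matrix ι ι K) (H : Matrix ι ι L) {s : Finset ι}
    (hs : C.rank < s.card) :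
    (Matrix.of fun i j => if i ∈ s then φ (C i j) else H i j).det = 0 := by
  have hli : ¬ LinearIndependent K (C.submatrix (Subtype.val : s → ι) id).row := by
    intro hli
    have h1 := Matrix.rank_submatrix_le C (Subtype.val : s → ι) id
    rw [hli.rank_matrix, Fintype.card_coe] at h1
    omega
  -- A linear relation among the rows in `s`, mapped to `L` and extended by zero, annihilates the
  -- whole matrix.
  obtain ⟨v, hv, ⟨i₀, hi₀⟩, hne⟩ := Fintype.not_linearIndependent_iff.1 hli
  refine Matrix.exists_vecMul_eq_zero_iff.1
    ⟨fun i => if h : i ∈ s then φ (v ⟨i, h⟩) else 0, fun h => hne ?_, ?_⟩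
  · simpa [hi₀] using congrFun h i₀
  · ext j
    have hj := congrArg φ (congrFun hv j)
    simp only [Matrix.row, Finset.sum_apply, Pi.smul_apply, Matrix.submatrix_apply, id_eq,
      smul_eq_mul, Pi.zero_apply, map_zero, map_sum, map_mul] at hj
    rw [Matrix.vecMul, dotProduct, Pi.zero_apply]
    refine Eq.trans ?_ hj
    rw [← Finset.sum_subset s.subset_univ,
      ← Finset.sum_attach, Finset.univ_eq_attach]
    · refine Finset.sum_congr rfl fun i _ => ?_
      simp
    · intro i _ hi
      simp [hi]

/-- If a matrix is the sum of a matrix over a subring `S` and of `t⁻¹` times a constant matrix of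
rank at most `r`, then `t ^ r` is a denominator of its determinant. -/
theorem pow_mul_det_mem_subring {K L ι : Type*} [Field K] [Field L] [Fintype ι]
    [DecidableEq ι] (φ : K →+* L) {S : Subring L} (hφ : ∀ a, φ a ∈ S) {t : L} (ht : t ∈ S)
    (ht0 : t ≠ 0) {C : Matrix ι ι K} {r : ℕ} (hC : C.rank ≤ r) {H : Matrix ι ι L}
    (hH : ∀ i j, H i j ∈ S) :
    t ^ r * (Matrix.of fun i j => t⁻¹ * φ (C i j) + H i j).det ∈ S := by
  -- Multilinearity in the rows: `s` is the set of rows taken from the singular part. Each such row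
  -- contributes one factor `t⁻¹`.
  have hsum : (Matrix.of fun i j => t⁻¹ * φ (C i j) + H i j).det =
      ∑ s : Finset ι, Matrix.detRowAlternating
        (s.piecewise (fun i j => t⁻¹ * φ (C i j)) H) := by
    exact AlternatingMap.map_add_univ Matrix.detRowAlternating
      (fun i j => t⁻¹ * φ (C i j)) H
  have hterm : ∀ s : Finset ι, Matrix.detRowAlternating
        (s.piecewise (fun i j => t⁻¹ * φ (C i j)) H) =
      t⁻¹ ^ s.card * (Matrix.of fun i j => if i ∈ s then φ (C i j) else H i j).det := by
    intro s
    have hprod : ∏ i, (if i ∈ s then t⁻¹ else 1) = t⁻¹ ^ s.card := by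
      rw [Finset.prod_ite_mem, Finset.univ_inter, Finset.prod_const]
    rw [← hprod, ← Matrix.det_mul_column]
    change Matrix.det _ = _
    congr 1
    ext i j
    change s.piecewise (fun i j => t⁻¹ * φ (C i j)) (fun i j => H i j) i j = _
    by_cases hi : i ∈ s
    · rw [Finset.piecewise_eq_of_mem _ _ _ hi]
      simp [hi]
    · rw [Finset.piecewise_eq_of_notMem _ _ _ hi]
      simp [hi]
  rw [hsum, Finset.mul_sum]
  refine S.sum_mem fun s _ => ?_
  rw [hterm]
  by_cases hs : s.card ≤ r
  · obtain ⟨k, rfl⟩ := Nat.exists_eq_add_of_le hs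
    have h1 : t ^ (s.card + k) * (t⁻¹ ^ s.card *
        (Matrix.of fun i j => if i ∈ s then φ (C i j) else H i j).det) =
        t ^ k * (Matrix.of fun i j => if i ∈ s then φ (C i j) else H i j).det := by
      rw [pow_add, inv_pow]
      field_simp
    rw [h1]
    refine S.mul_mem (S.pow_mem ht k) (det_mem_subring S fun i j => ?_)
    by_cases hi : i ∈ s
    · simpa [hi] using hφ _
    · simpa [hi] using hH i j
  · rw [det_piecewise_eq_zero_of_rank_lt φ C H (by omega)]
    simp

/-! ### The inverse of the filtered transfer function -/

/-- The matrix `I - A (s I - Γ)⁻¹`. -/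
noncomputable def returnDifference {n : ℕ} (γ : Fin n → ℝ) (A : Matrix (Fin n) (Fin n) ℝ) :
    Matrix (Fin n) (Fin n) (RatFunc ℝ) :=
  Matrix.of fun i j => (if i = j then 1 else 0) -
    RatFunc.C (A i j) * (RatFunc.X - RatFunc.C (γ j))⁻¹

theorem X_sub_C_eq_algebraMap (c : ℝ) :
    (RatFunc.X - RatFunc.C c : RatFunc ℝ) = algebraMap ℝ[X] (RatFunc ℝ) (X - C c) := by
  simp

theorem ratFunc_X_sub_C_ne_zero (c : ℝ) : (RatFunc.X - RatFunc.C c : RatFunc ℝ) ≠ 0 := by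
  rw [X_sub_C_eq_algebraMap]
  exact RatFunc.algebraMap_ne_zero (X_sub_C_ne_zero c)

theorem returnDifference_mul {n : ℕ} (γ : Fin n → ℝ) (A : Matrix (Fin n) (Fin n) ℝ) :
    returnDifference γ A * sIMinus (Matrix.diagonal γ) = sIMinus (Matrix.diagonal γ + A) := by
  have hF : sIMinus (Matrix.diagonal γ) =
      Matrix.diagonal fun j => RatFunc.X - RatFunc.C (γ j) := by
    ext i j : 2
    by_cases hij : i = j
    · subst hij
      simp [sIMinus]
    · simp [sIMinus, hij]
  ext i j : 2
  rw [hF, Matrix.mul_diagonal]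
  have h0 := ratFunc_X_sub_C_ne_zero (γ j)
  by_cases hij : i = j
  · subst hij
    simp only [returnDifference, Matrix.of_apply, if_true, sub_mul, mul_assoc,
      inv_mul_cancel₀ h0]
    simp [sIMinus]
    ring
  · simp only [returnDifference, Matrix.of_apply, hij, if_false, sub_mul, mul_assoc,
      inv_mul_cancel₀ h0]
    simp [sIMinus, hij]

theorem returnDifference_mul_filteredTransferFunction {n : ℕ} (γ : Fin n → ℝ)
    (A : Matrix (Fin n) (Fin n) ℝ) :
    returnDifference γ A * filteredTransferFunction γ A = 1 := by
  rw [filteredTransferFunction, transferFunction, ← mul_assoc, returnDifference_mul,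
    Matrix.mul_nonsing_inv _ (isUnit_det_sIMinus _)]

/-- The poles of W̄ lie among the eigenvalues of Γ + A, which depend on the weights; those of its
inverse lie among the fixed numbers γ_j. -/
theorem complexityIndex_eq_mcMillanDegree {n : ℕ} (γ : Fin n → ℝ)
    (A : Matrix (Fin n) (Fin n) ℝ) :
    complexityIndex γ A = mcMillanDegree (returnDifference γ A) :=
  mcMillanDegree_eq_of_mul_eq_one (returnDifference_mul_filteredTransferFunction γ A)

theorem pointOrder_X_sub_C (c : ℝ) (α : ℂ) :
    pointOrder (α : OnePoint ℂ) (RatFunc.X - RatFunc.C c) = if α = (c : ℂ) then 1 else 0 := by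
  rw [X_sub_C_eq_algebraMap, pointOrder_algebraMap]
  simp [rootMultiplicity_X_sub_C]

theorem C_mem_regularSubring (p : OnePoint ℂ) (a : ℝ) : RatFunc.C a ∈ regularSubring p := by
  rw [mem_regularSubring]
  induction p with
  | infty => simp [poleMultiplicity_infty]
  | coe α => simp [poleMultiplicity_coe_eq_zero_iff]

theorem inv_X_sub_C_mem_regularSubring {p : OnePoint ℂ} {c : ℝ}
    (h : p ≠ ((c : ℂ) : OnePoint ℂ)) :
    (RatFunc.X - RatFunc.C c : RatFunc ℝ)⁻¹ ∈ regularSubring p := by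
  rw [mem_regularSubring]
  induction p with
  | infty =>
    rw [poleMultiplicity_infty, RatFunc.intDegree_inv, X_sub_C_eq_algebraMap,
      RatFunc.intDegree_polynomial]
    simp
  | coe α =>
    have h1 := natCast_poleMultiplicity (RatFunc.X - RatFunc.C c)⁻¹ (α : OnePoint ℂ)
    have h2 : α ≠ (c : ℂ) := fun h' => h (congrArg _ h')
    rw [pointOrder_inv, pointOrder_X_sub_C, if_neg h2] at h1
    simpa using h1

theorem returnDifference_mem_regularSubring {n : ℕ} (γ : Fin n → ℝ)
    (A : Matrix (Fin n) (Fin n) ℝ) {p : OnePoint ℂ} {j : Fin n}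
    (h : p ≠ ((γ j : ℂ) : OnePoint ℂ)) (i : Fin n) :
    returnDifference γ A i j ∈ regularSubring p := by
  refine sub_mem ?_ (mul_mem (C_mem_regularSubring _ _) (inv_X_sub_C_mem_regularSubring h))
  split_ifs
  · exact one_mem _
  · exact zero_mem _

theorem poleMultiplicity_le_of_pow_mul_mem {c : ℝ} {d : RatFunc ℝ} {r : ℕ}
    (h : (RatFunc.X - RatFunc.C c) ^ r * d ∈ regularSubring ((c : ℂ) : OnePoint ℂ)) :
    poleMultiplicity d ((c : ℂ) : OnePoint ℂ) ≤ r := by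
  by_cases hd : d = 0
  · rw [hd]
    exact (mem_regularSubring.1 (zero_mem (regularSubring _))).trans_le (Nat.zero_le _)
  · have h0 := ratFunc_X_sub_C_ne_zero c
    have h1 := natCast_poleMultiplicity ((RatFunc.X - RatFunc.C c) ^ r * d)
      ((c : ℂ) : OnePoint ℂ)
    rw [mem_regularSubring.1 h, pointOrder_mul _ (pow_ne_zero r h0) hd, pointOrder_pow _ h0,
      pointOrder_X_sub_C, if_pos rfl] at h1
    have h2 := natCast_poleMultiplicity d ((c : ℂ) : OnePoint ℂ)
    omega

theorem poleDegree_returnDifference_le {n : ℕ} (γ : Fin n → ℝ)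
    (A : Matrix (Fin n) (Fin n) ℝ) (c : ℝ) :
    poleDegree (returnDifference γ A) ((c : ℂ) : OnePoint ℂ) ≤ (columnPart γ A c).rank := by
  refine poleDegree_le fun r f g => poleMultiplicity_le_of_pow_mul_mem ?_
  have h0 := ratFunc_X_sub_C_ne_zero c
  have hrank : ((columnPart γ A c).submatrix f g).rank ≤ (columnPart γ A c).rank :=
    Matrix.rank_submatrix_le _ _ _
  have hX : (RatFunc.X - RatFunc.C c : RatFunc ℝ) ∈ regularSubring ((c : ℂ) : OnePoint ℂ) := by
    have h1 := natCast_poleMultiplicity (RatFunc.X - RatFunc.C c) ((c : ℂ) : OnePoint ℂ)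
    rw [pointOrder_X_sub_C, if_pos rfl] at h1
    simpa [mem_regularSubring] using h1
  -- The part regular at `c`: columns with `γ = c` keep only their identity entries, the others are
  -- kept whole.
  let H : Matrix (Fin r) (Fin r) (RatFunc ℝ) := Matrix.of fun i j =>
    (if γ (g j) = c then if f i = g j then 1 else 0 else returnDifference γ A (f i) (g j))
  have hH : ∀ i j, H i j ∈ regularSubring ((c : ℂ) : OnePoint ℂ) := by
    intro i j
    simp only [H, Matrix.of_apply]
    split_ifs with h1
    · exact one_mem _
    · exact zero_mem _
    · refine returnDifference_mem_regularSubring γ A (fun h => h1 ?_) _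
      exact (Complex.ofReal_injective (OnePoint.coe_injective h)).symm
  have hneg : (-(columnPart γ A c).submatrix f g).rank ≤ (columnPart γ A c).rank := by
    rw [← neg_one_smul ℝ, Matrix.rank_smul_of_mem_nonZeroDivisors _ (by simp)]
    exact hrank
  have key := pow_mul_det_mem_subring RatFunc.C
    (C_mem_regularSubring ((c : ℂ) : OnePoint ℂ)) hX h0 hneg hH
  have heq : (returnDifference γ A).submatrix f g = Matrix.of fun i j =>
      (RatFunc.X - RatFunc.C c)⁻¹ *
        RatFunc.C ((-(columnPart γ A c).submatrix f g) i j) + H i j := by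
    ext i j : 2
    by_cases h1 : γ (g j) = c
    · simp only [returnDifference, columnPart, H, Matrix.submatrix_apply, Matrix.of_apply,
        Matrix.neg_apply, h1, if_true, map_neg]
      ring
    · simp [columnPart, H, h1]
  rw [heq]
  exact key

theorem le_poleDegree_returnDifference {n : ℕ} (γ : Fin n → ℝ)
    (A : Matrix (Fin n) (Fin n) ℝ) (c : ℝ) :
    (columnPart γ A c).rank ≤ poleDegree (returnDifference γ A) ((c : ℂ) : OnePoint ℂ) := by
  obtain ⟨r, hr⟩ : ∃ r, (columnPart γ A c).rank = r := ⟨_, rfl⟩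
  obtain ⟨f, g, hfg⟩ := exists_det_submatrix_ne_zero_of_rank_eq hr
  rw [hr]
  refine le_trans ?_ (poleMultiplicity_le_poleDegree _ _ f g)
  -- A nonzero minor of `C_c` avoids the zeroed columns.
  have hg : ∀ j, γ (g j) = c := by
    intro j
    by_contra h
    exact hfg (Matrix.det_eq_zero_of_column_eq_zero j fun i => by simp [columnPart, h])
  have h0 := ratFunc_X_sub_C_ne_zero c
  -- `Q` is the selected submatrix multiplied by `s - c`. It is polynomial, and at `s = c` only the
  -- block of `-C_c` survives, so `det Q` does not vanish there and the minor has a pole of order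
  -- exactly `r`.
  let Q : Matrix (Fin r) (Fin r) ℝ[X] := Matrix.of fun i j =>
    (X - C c) * (if f i = g j then 1 else 0) - C (A (f i) (g j))
  have hQ : (RatFunc.X - RatFunc.C c) ^ r * ((returnDifference γ A).submatrix f g).det =
      algebraMap ℝ[X] (RatFunc ℝ) Q.det := by
    have h1 := Matrix.det_mul_column (fun _ => RatFunc.X - RatFunc.C c)
      ((returnDifference γ A).submatrix f g)
    rw [Finset.prod_const, Finset.card_univ, Fintype.card_fin] at h1
    rw [← h1, RingHom.map_det]
    congr 1
    ext i j : 2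
    simp only [returnDifference, Q, Matrix.of_apply, Matrix.submatrix_apply, hg,
      RingHom.mapMatrix_apply, Matrix.map_apply, map_sub, map_mul, RatFunc.algebraMap_X,
      RatFunc.algebraMap_C]
    rw [mul_sub, mul_left_comm, mul_inv_cancel₀ h0, mul_one]
    split_ifs <;> simp
  have hev : Q.det.eval c ≠ 0 := by
    have h1 : Q.det.eval c = (-(columnPart γ A c).submatrix f g).det := by
      rw [← coe_evalRingHom, RingHom.map_det]
      congr 1
      ext i j : 2
      simp [Q, columnPart, hg, apply_ite (eval c)]
    rw [h1, Matrix.det_neg]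
    exact mul_ne_zero (pow_ne_zero _ (by norm_num)) hfg
  have hd : ((returnDifference γ A).submatrix f g).det ≠ 0 := by
    intro h
    rw [h, mul_zero, eq_comm, map_eq_zero_iff _ (RatFunc.algebraMap_injective ℝ)] at hQ
    simp [hQ] at hev
  have hroot : (Q.det.map (algebraMap ℝ ℂ)).rootMultiplicity (c : ℂ) = 0 := by
    apply rootMultiplicity_eq_zero
    rw [IsRoot.def, eval_map_algebraMap]
    have := aeval_algebraMap_apply_eq_algebraMap_eval (A := ℂ) c Q.det
    rw [Complex.coe_algebraMap] at this
    rw [this]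
    exact_mod_cast hev
  have h1 := congrArg (pointOrder ((c : ℂ) : OnePoint ℂ)) hQ
  rw [pointOrder_mul _ (pow_ne_zero r h0) hd, pointOrder_pow _ h0, pointOrder_X_sub_C,
    if_pos rfl, pointOrder_algebraMap, hroot] at h1
  have h2 := natCast_poleMultiplicity ((returnDifference γ A).submatrix f g).det
    ((c : ℂ) : OnePoint ℂ)
  omega

theorem complexityIndex_eq_sum_rank {n : ℕ} (γ : Fin n → ℝ) (A : Matrix (Fin n) (Fin n) ℝ) :
    complexityIndex γ A = ∑ c ∈ Finset.univ.image γ, (columnPart γ A c).rank := by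
  classical
  have hinj : Function.Injective fun c : ℝ => ((c : ℂ) : OnePoint ℂ) :=
    OnePoint.coe_injective.comp Complex.ofReal_injective
  rw [complexityIndex_eq_mcMillanDegree, mcMillanDegree_eq_sum
    (S := (Finset.univ.image γ).image fun c : ℝ => ((c : ℂ) : OnePoint ℂ)),
    Finset.sum_image hinj.injOn]
  · exact Finset.sum_congr rfl fun c _ => le_antisymm (poleDegree_returnDifference_le γ A c)
      (le_poleDegree_returnDifference γ A c)
  · rintro p ⟨i, j, hp⟩
    by_contra h
    refine hp.ne' (mem_regularSubring.1 (returnDifference_mem_regularSubring γ A ?_ i))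
    rintro rfl
    exact h (Finset.mem_image_of_mem _ (Finset.mem_image_of_mem _ (Finset.mem_univ j)))

/-! ### Genericity -/

/-- The matrix of indeterminate edge weights, restricted to the columns of the parameter `c`. -/
noncomputable def genericColumnPart {n : ℕ} (γ : Fin n → ℝ) (E : Finset (Fin n × Fin n))
    (c : ℝ) : Matrix (Fin n) (Fin n) (MvPolynomial E ℝ) :=
  Matrix.of fun i j => if γ j = c then
    if h : (j, i) ∈ E then MvPolynomial.X ⟨(j, i), h⟩ else 0 else 0

theorem eval_det_genericColumnPart {n r : ℕ} (γ : Fin n → ℝ) (E : Finset (Fin n × Fin n))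
    (c : ℝ) (f g : Fin r → Fin n) (w : E → ℝ) :
    MvPolynomial.eval w ((genericColumnPart γ E c).submatrix f g).det =
      ((columnPart γ (weightMatrix E w) c).submatrix f g).det := by
  rw [RingHom.map_det]
  congr 1
  ext i j
  simp only [genericColumnPart, columnPart, weightMatrix, RingHom.mapMatrix_apply,
    Matrix.map_apply, Matrix.submatrix_apply, Matrix.of_apply]
  split_ifs <;> simp

/-- Off a hypersurface, the rank of `C_c` is maximal. -/
theorem exists_mvPolynomial_rank_columnPart_le {n : ℕ} (γ : Fin n → ℝ)
    (E : Finset (Fin n × Fin n)) (c : ℝ) :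
    ∃ P : MvPolynomial E ℝ, P ≠ 0 ∧ ∀ w, MvPolynomial.eval w P ≠ 0 → ∀ w',
      (columnPart γ (weightMatrix E w') c).rank ≤ (columnPart γ (weightMatrix E w) c).rank := by
  have hbdd : BddAbove (Set.range fun w : E → ℝ => (columnPart γ (weightMatrix E w) c).rank) :=
    ⟨n, by rintro _ ⟨w, rfl⟩; exact Matrix.rank_le_width _⟩
  -- `w₀` attains the maximal rank. A minor nonzero there is a polynomial whose nonvanishing at any
  -- `w` forces the rank up to that maximum.
  obtain ⟨w₀, hw₀⟩ := Nat.sSup_mem (Set.range_nonempty _) hbdd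
  obtain ⟨f, g, hfg⟩ := exists_det_submatrix_ne_zero_of_rank_eq hw₀
  rw [← eval_det_genericColumnPart] at hfg
  refine ⟨((genericColumnPart γ E c).submatrix f g).det, fun h => hfg (by rw [h, map_zero]), fun w hw w' => ?_⟩
  rw [eval_det_genericColumnPart] at hw
  exact (le_csSup hbdd ⟨w', rfl⟩).trans (le_rank_of_det_submatrix_ne_zero hw)

theorem exists_mvPolynomial_complexityIndex_le {n : ℕ} (γ : Fin n → ℝ)
    (E : Finset (Fin n × Fin n)) :
    ∃ P : MvPolynomial E ℝ, P ≠ 0 ∧ ∀ w, MvPolynomial.eval w P ≠ 0 → ∀ w',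
      complexityIndex γ (weightMatrix E w') ≤ complexityIndex γ (weightMatrix E w) := by
  choose P hP hle using exists_mvPolynomial_rank_columnPart_le γ E
  refine ⟨∏ c ∈ Finset.univ.image γ, P c, Finset.prod_ne_zero_iff.2 fun c _ => hP c,
    fun w hw w' => ?_⟩
  rw [map_prod, Finset.prod_ne_zero_iff] at hw
  rw [complexityIndex_eq_sum_rank, complexityIndex_eq_sum_rank]
  exact Finset.sum_le_sum fun c hc => hle c w (hw c hc) w'

end NetworkComplexity

theorem mainTheorem2 (n : ℕ) (γ : Fin n → ℝ) (E : Finset (Fin n × Fin n)) :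
    -- the structural index is an attained maximum
    IsGreatest
      (Set.range fun w : E → ℝ =>
        NetworkComplexity.complexityIndex γ (NetworkComplexity.weightMatrix E w))
      (NetworkComplexity.structuralComplexityIndex γ E) ∧
    -- the complexity index equals it for almost all edge weights
    NetworkComplexity.ForAlmostAll (fun w : E → ℝ =>
      NetworkComplexity.complexityIndex γ (NetworkComplexity.weightMatrix E w) =
        NetworkComplexity.structuralComplexityIndex γ E) ∧
    -- for all edge weights, the index is a sum of ranks over the distinct node parameters
    ∀ w : E → ℝ,
      NetworkComplexity.complexityIndex γ (NetworkComplexity.weightMatrix E w) =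
        ∑ c ∈ Finset.univ.image γ,
          (NetworkComplexity.columnPart γ (NetworkComplexity.weightMatrix E w) c).rank := by
  obtain ⟨P, hP, hmax⟩ := NetworkComplexity.exists_mvPolynomial_complexityIndex_le γ E
  -- A nonzero polynomial over the infinite field ℝ is not identically zero. The point `w₀` both
  -- attains the maximum and shows that the variety is proper.
  obtain ⟨w₀, hw₀⟩ : ∃ w, MvPolynomial.eval w P ≠ 0 := by
    by_contra! h
    exact hP (MvPolynomial.funext fun w => by rw [h w, map_zero])
  have hgreatest : ∀ w, MvPolynomial.eval w P ≠ 0 → IsGreatest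
      (Set.range fun w : E → ℝ =>
        NetworkComplexity.complexityIndex γ (NetworkComplexity.weightMatrix E w))
      (NetworkComplexity.complexityIndex γ (NetworkComplexity.weightMatrix E w)) := by
    refine fun w hw => ⟨⟨w, rfl⟩, ?_⟩
    rintro _ ⟨w', rfl⟩
    exact hmax w hw w'
  -- In ℕ the supremum of an unbounded set is `0` by default; having a greatest element excludes
  -- that case.
  have heq : ∀ w, MvPolynomial.eval w P ≠ 0 →
      NetworkComplexity.complexityIndex γ (NetworkComplexity.weightMatrix E w) =
        NetworkComplexity.structuralComplexityIndex γ E :=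
    fun w hw => (hgreatest w hw).csSup_eq.symm
  refine ⟨heq w₀ hw₀ ▸ hgreatest w₀ hw₀, ⟨Ideal.span {P}, fun h => hw₀ ?_, fun w hw => ?_⟩,
    fun w => NetworkComplexity.complexityIndex_eq_sum_rank γ _⟩
  · have h1 : w₀ ∈ MvPolynomial.zeroLocus ℝ (Ideal.span {P}) := h ▸ Set.mem_univ _
    simpa [MvPolynomial.aeval_eq_eval] using h1 P (Ideal.subset_span rfl)
  · refine heq w fun h => hw fun q hq => ?_
    obtain ⟨a, rfl⟩ := Ideal.mem_span_singleton.1 hq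
    simp [MvPolynomial.aeval_eq_eval, h]
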